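/- Let $f:\mathbb{Z}_+\to\mathbb{R}$ be increasing and strictly concave (that is, $f(k+2)-f(k+1)<f(k+1)-f(k)$ for all $k\ge 0$) with $f(0)=0$. Let $\xi\in\{0,1\}^n$, let $\mathcal{Z}=\{i:\xi_i=1\}$, and let $\beta$ be an integer with $1\le\beta\le|\mathcal{Z}|-2$. Write $z^+=\max\{z,0\}$ and $[m]=\{1,\dots,m\}$, let $\mathrm{Co}$ denote the convex hull in $\mathbb{R}\times\mathbb{R}^n$, and put $$\mathcal{X}=\{(\theta,x)\in\mathbb{R}\times\{0,1\}^n:\ \theta\le f((x^\top\xi-\beta)^+)\}.$$ For $\ell\ge1$ let $a_\ell=f(\ell)-f(\ell-1)$ and $b_\ell=f(\ell)-a_\ell\,\ell$. Let $L=[|\mathcal{Z}|-\beta]$, $$L_1=\Big\{(\ell,\rho):\ \ell\in L,\ \rho=\tfrac{b_\ell}{a_\ell}\Big\},\qquad L_2=\Big\{(\ell,\rho):\ \ell\in L,\ \rho\in[\beta]\cap\Big(\tfrac{b_\ell}{a_\ell},\tfrac{b_{\ell+1}}{a_{\ell+1}}\Big)\Big\}.$$ For $(\ell,\rho)\in L_1\cup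 L_2$ and $z\in\mathbb{Z}_+$ let $$h_{(\ell,\rho)}(z)=\Big(\tfrac{f(\ell)}{\ell+\rho}\,\bigl(z-(\beta-\rho)\bigr)\Big)^+,\qquad \mathcal{X}_{(\ell,\rho)}=\{(\theta,x)\in\mathbb{R}\times\{0,1\}^n:\ \theta\le h_{(\ell,\rho)}(x^\top\xi)\}.$$ Finally, for $T\subseteq[n]$ with indicator vector $x_T$ let $\phi_{(\ell,\rho)}(T)=-h_{(\ell,\rho)}(x_T^\top\xi)$. Then: 1. $\displaystyle \mathrm{Co}(\mathcal{X})=\bigcap_{(\ell,\rho)\in L_1\cup L_2}\mathrm{Co}(\mathcal{X}_{(\ell,\rho)}).$ 2. For every $(\ell,\rho)\in L_1\cup L_2$ the set function $\phi=\phi_{(\ell,\rho)}$ is submodular, and $\mathrm{Co}(\mathcal{X}_{(\ell,\rho)})$ is described by its extended polymatroid inequalities: it is the set of all $(\theta,x)\in\mathbb{R}\times[0,1]^n$ such that, for every permutation $\sigma$ of $[n]$, with $T_k=\{\sigma_1,\dots,\sigma_k\}$ and $T_0=\varnothing$, $$\phi(\varnothing)+\sum_{k=1}^n\bigl[\phi(T_k)-\phi(T_{k-1})\bigr]x_{\sigma_k}\le-\theta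 .$$ 3. Consequently $\mathrm{Co}(\mathcal{X})$ is the set of all $(\theta,x)\in\mathbb{R}\times[0,1]^n$ that satisfy the extended polymatroid inequalities of $\phi_{(\ell,\rho)}$ for all $(\ell,\rho)\in L_1\cup L_2$ and all permutations $\sigma$ of $[n]$. -/

import Mathlib

/-- `f : ℤ₊ → ℝ` is strictly concave: its increments are strictly decreasing. -/
def StrictlyConcaveSeq (f : ℕ → ℝ) : Prop :=
  ∀ k : ℕ, f (k + 2) - f (k + 1) < f (k + 1) - f k

/-- A vector all of whose entries are `0` or `1`. -/
def IsBinary {n : ℕ} (x : Fin n → ℕ) : Prop := ∀ i, x i = 0 ∨ x i = 1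

/-- The index set `𝒵` of the entries of `ξ` equal to `1`. -/
def supportOnes {n : ℕ} (ξ : Fin n → ℕ) : Finset (Fin n) := Finset.univ.filter fun i => ξ i = 1

/-- The hypograph `{(θ, x) ∈ ℝ × {0,1}ⁿ : θ ≤ g x}`, as a subset of `ℝ × ℝⁿ`. -/
def binaryHypograph {n : ℕ} (g : (Fin n → ℕ) → ℝ) : Set (ℝ × (Fin n → ℝ)) :=
  {p | ∃ x : Fin n → ℕ, IsBinary x ∧ p.2 = (fun i => (x i : ℝ)) ∧ p.1 ≤ g x}

/-- The function `x ↦ f ((xᵀξ - β)⁺)`; truncated subtraction in `ℕ` is the positive part. -/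
def shiftedFun {n : ℕ} (f : ℕ → ℝ) (ξ : Fin n → ℕ) (β : ℕ) (x : Fin n → ℕ) : ℝ :=
  f ((∑ i, x i * ξ i) - β)

/-- `a_ℓ = f(ℓ) - f(ℓ-1)`, used for `ℓ ≥ 1` only. -/
noncomputable def pieceSlope (f : ℕ → ℝ) (l : ℕ) : ℝ := f l - f (l - 1)

/-- `b_ℓ = f(ℓ) - a_ℓ ℓ`, used for `ℓ ≥ 1` only. -/
noncomputable def pieceIntercept (f : ℕ → ℝ) (l : ℕ) : ℝ := f l - pieceSlope f l * (l : ℝ)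

/-- `L = [|𝒵| - β] = {1, …, |𝒵| - β}`. -/
def indexL {n : ℕ} (ξ : Fin n → ℕ) (β : ℕ) : Finset ℕ :=
  Finset.Icc 1 ((supportOnes ξ).card - β)

/-- `L₁ = {(ℓ, ρ) : ℓ ∈ L, ρ = b_ℓ / a_ℓ}`. -/
def indexL1 {n : ℕ} (f : ℕ → ℝ) (ξ : Fin n → ℕ) (β : ℕ) : Set (ℕ × ℝ) :=
  {p | p.1 ∈ indexL ξ β ∧ p.2 = pieceIntercept f p.1 / pieceSlope f p.1}

/-- `L₂ = {(ℓ, ρ) : ℓ ∈ L, ρ ∈ {1, …, β} ∩ (b_ℓ / a_ℓ, b_{ℓ+1} / a_{ℓ+1})}`. -/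
def indexL2 {n : ℕ} (f : ℕ → ℝ) (ξ : Fin n → ℕ) (β : ℕ) : Set (ℕ × ℝ) :=
  {p | p.1 ∈ indexL ξ β ∧ (∃ r ∈ Finset.Icc 1 β, p.2 = (r : ℝ)) ∧
    p.2 ∈ Set.Ioo (pieceIntercept f p.1 / pieceSlope f p.1)
      (pieceIntercept f (p.1 + 1) / pieceSlope f (p.1 + 1))}

/-- `h_{(ℓ,ρ)}(z) = (f(ℓ) / (ℓ + ρ) * (z - (β - ρ)))⁺`, where `q = (ℓ, ρ)`. -/
noncomputable def hFun (f : ℕ → ℝ) (β : ℕ) (q : ℕ × ℝ) (z : ℕ) : ℝ :=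
  max (f q.1 / ((q.1 : ℝ) + q.2) * ((z : ℝ) - ((β : ℝ) - q.2))) 0

/-- The function `x ↦ h_{(ℓ,ρ)}(xᵀξ)`. -/
noncomputable def hShifted {n : ℕ} (f : ℕ → ℝ) (ξ : Fin n → ℕ) (β : ℕ) (q : ℕ × ℝ)
    (x : Fin n → ℕ) : ℝ :=
  hFun f β q (∑ i, x i * ξ i)

/-- The set function `T ↦ g(x_T)`, where `x_T` is the indicator vector of `T`. -/
def toSetFun {n : ℕ} (g : (Fin n → ℕ) → ℝ) (T : Finset (Fin n)) : ℝ :=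
  g fun i => if i ∈ T then 1 else 0

/-- Submodularity of a set function on the subsets of `[n]`. -/
def IsSubmodularSetFun {n : ℕ} (φ : Finset (Fin n) → ℝ) : Prop :=
  ∀ R T : Finset (Fin n), φ (R ∪ T) + φ (R ∩ T) ≤ φ R + φ T

/-- `T_k = {σ₁, …, σ_k}`: the first `k` elements in the order given by `σ`. -/
def permPrefix {n : ℕ} (σ : Equiv.Perm (Fin n)) (k : ℕ) : Finset (Fin n) :=
  (Finset.univ.filter fun j : Fin n => (j : ℕ) < k).image σ

/-- The extended polymatroid inequality of `φ` and the permutation `σ` at the point `(θ, x)`: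
`φ(∅) + ∑ₖ (φ(T_k) - φ(T_{k-1})) x_{σ_k} ≤ θ`; here `k : Fin n` counts from `0`. -/
def ExtendedPolymatroidIneq {n : ℕ} (φ : Finset (Fin n) → ℝ) (σ : Equiv.Perm (Fin n))
    (θ : ℝ) (x : Fin n → ℝ) : Prop :=
  φ ∅ + ∑ k : Fin n, (φ (permPrefix σ ((k : ℕ) + 1)) - φ (permPrefix σ (k : ℕ))) * x (σ k) ≤ θ

/-! All functions involved depend on a set `T` only through `z = |T ∩ 𝒵|`. Each `h_{(ℓ,ρ)}` is a
hinge: the positive part of a line through `(β + ℓ, f ℓ)` with slope in `[a_{ℓ+1}, a_ℓ]`. Such a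
line supports the concave sequence `f` at `ℓ`, so the hinge majorizes `f((z - β)⁺)`, which gives the
inclusion `⊆`. A hinge is also convex in `z`, hence supermodular as a set function, and its hull is
given by the greedy (Edmonds–Lovász) inequalities: `convexHull_binaryHypograph_of_submodular`.

For `⊇`, a point outside `Co(𝒳)` lies above an affine majorant (`exists_affine_majorant`).
Minimizing the majorant over sets with fixed `|T ∩ 𝒵|` gives a discretely convex `w` above `f((z -
β)⁺)` (`exists_convex_minorant`). Some hinge fits below `w` (`exists_hinge_le`), and on the integers
it is a convex combination of two members of the family (`exists_convex_comb_hFun`). The two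
corresponding inequalities, for the one order that sorts `x`, then average to a contradiction. -/

/-! ### Chains of prefixes and extended polymatroid inequalities -/

/-- The indicator vector of `T`. -/
def indicatorVec {n : ℕ} (T : Finset (Fin n)) (i : Fin n) : ℝ := if i ∈ T then 1 else 0

theorem binaryHypograph_eq {n : ℕ} (g : (Fin n → ℕ) → ℝ) :
    binaryHypograph g = {p | ∃ T, p.2 = indicatorVec T ∧ p.1 ≤ toSetFun g T} := by
  ext p
  constructor
  · rintro ⟨x, hx, hp, hg⟩
    have hxT : (fun i => if i ∈ Finset.univ.filter (fun i => x i = 1) then 1 else 0) = x := by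
      funext i
      rcases hx i with h | h <;> simp [h]
    refine ⟨Finset.univ.filter fun i => x i = 1, ?_, ?_⟩
    · rw [hp]
      funext i
      rcases hx i with h | h <;> simp [h, indicatorVec]
    · unfold toSetFun
      rwa [hxT]
  · rintro ⟨T, hp, hg⟩
    refine ⟨fun i => if i ∈ T then 1 else 0, fun i => by by_cases h : i ∈ T <;> simp [h], ?_, hg⟩
    rw [hp]
    funext i
    by_cases h : i ∈ T <;> simp [h, indicatorVec]

theorem permPrefix_zero {n : ℕ} (σ : Equiv.Perm (Fin n)) : permPrefix σ 0 = ∅ := by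
  simp [permPrefix]

theorem mem_permPrefix {n : ℕ} (σ : Equiv.Perm (Fin n)) (k : ℕ) (i : Fin n) :
    i ∈ permPrefix σ k ↔ (σ.symm i : ℕ) < k := by
  simp only [permPrefix, Finset.mem_image, Finset.mem_filter, Finset.mem_univ, true_and]
  constructor
  · rintro ⟨j, hj, rfl⟩
    simpa using hj
  · intro h
    exact ⟨σ.symm i, h, by simp⟩

/-- Abel summation; it turns the left side of a polymatroid inequality into a weighted sum over
prefixes. -/
theorem sum_sub_mul_eq (y φ : ℕ → ℝ) (N : ℕ) :
    ∑ k ∈ Finset.range (N + 1), (y k - y (k + 1)) * φ k =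
      φ 0 * y 0 + ∑ k ∈ Finset.range N, (φ (k + 1) - φ k) * y (k + 1) - y (N + 1) * φ N := by
  induction N with
  | zero => simp; ring
  | succ N ih =>
    rw [Finset.sum_range_succ, ih, Finset.sum_range_succ]
    ring

theorem sum_permPrefix_indicator {n : ℕ} (σ : Equiv.Perm (Fin n)) (x : Fin n → ℝ) (i : Fin n) :
    indicatorVec ∅ i + ∑ k : Fin n, (indicatorVec (permPrefix σ ((k : ℕ) + 1)) i -
      indicatorVec (permPrefix σ (k : ℕ)) i) * x (σ k) = x i := by
  rw [Finset.sum_eq_single (σ.symm i)]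
  · simp [indicatorVec, mem_permPrefix]
  · intro k _ hk
    have hk' : (k : ℕ) ≠ (σ.symm i : ℕ) := fun h => hk (Fin.ext h)
    have : ((σ.symm i : ℕ) < (k : ℕ) + 1) ↔ ((σ.symm i : ℕ) < (k : ℕ)) := by omega
    simp [indicatorVec, mem_permPrefix, this]
  · simp

/-- A point of the cube is a convex combination of the indicator vectors of the prefixes of an
order that sorts its entries decreasingly. -/
theorem exists_chain_weights {n : ℕ} (x : Fin n → ℝ) (hx : ∀ i, x i ∈ Set.Icc (0 : ℝ) 1) :
    ∃ (σ : Equiv.Perm (Fin n)) (c : ℕ → ℝ), (∀ k, 0 ≤ c k) ∧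
      (∀ φ : Finset (Fin n) → ℝ,
        φ ∅ + ∑ k : Fin n, (φ (permPrefix σ ((k : ℕ) + 1)) - φ (permPrefix σ (k : ℕ))) * x (σ k) =
          ∑ k ∈ Finset.range (n + 1), c k * φ (permPrefix σ k)) ∧
      ∑ k ∈ Finset.range (n + 1), c k = 1 ∧
      ∑ k ∈ Finset.range (n + 1), c k • indicatorVec (permPrefix σ k) = x := by
  set σ := Tuple.sort (fun i => -x i) with hσ
  have hmono : Monotone ((fun i => -x i) ∘ σ) := Tuple.monotone_sort _
  -- The sorted entries of `x`, shifted by one and padded with `1` in front and `0` behind. The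
  -- successive drops are then nonnegative and sum to `1`; they are the weights.
  let y : ℕ → ℝ := fun k => if k = 0 then 1 else if h : k - 1 < n then x (σ ⟨k - 1, h⟩) else 0
  have hy0 : y 0 = 1 := by simp [y]
  have hys : ∀ k : Fin n, y ((k : ℕ) + 1) = x (σ k) := fun k => by simp [y]
  have hyn : y (n + 1) = 0 := by simp [y]
  have hanti : ∀ k, 0 ≤ y k - y (k + 1) := by
    intro k
    rcases k with _ | k
    · simp only [y]
      by_cases h : 0 < n
      · have := (hx (σ ⟨0, h⟩)).2
        simp [h, this]
      · simp [h]
    · by_cases h1 : k + 1 < n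
      · have h2 : k < n := by omega
        have := hmono (show (⟨k, h2⟩ : Fin n) ≤ ⟨k + 1, h1⟩ by simp)
        simp only [Function.comp] at this
        simp only [y]
        simp [h1, h2]
        linarith
      · by_cases h2 : k < n
        · have := (hx (σ ⟨k, h2⟩)).1
          simp [y, h1, h2, this]
        · simp [y, h1, h2]
  have key : ∀ φ : Finset (Fin n) → ℝ,
      φ ∅ + ∑ k : Fin n, (φ (permPrefix σ ((k : ℕ) + 1)) - φ (permPrefix σ (k : ℕ))) * x (σ k) =
        ∑ k ∈ Finset.range (n + 1), (y k - y (k + 1)) * φ (permPrefix σ k) := by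
    intro φ
    rw [sum_sub_mul_eq y (fun k => φ (permPrefix σ k)) n, hyn, hy0, permPrefix_zero,
      Finset.sum_range]
    simp only [hys]
    ring
  refine ⟨σ, fun k => y k - y (k + 1), hanti, key, ?_, ?_⟩
  · have := key fun _ => 1
    simpa using this.symm
  · funext i
    have := key fun T => indicatorVec T i
    rw [sum_permPrefix_indicator] at this
    simp only [Finset.sum_apply, Pi.smul_apply, smul_eq_mul]
    exact this.symm

/-- Greedy argument: by diminishing returns, adding `σ_N ∈ S` to the whole prefix raises `φ` by at
most what adding it to `S ∩ T_N` does. These increments telescope to `φ S`. -/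
theorem sum_permPrefix_le_of_submodular {n : ℕ} {φ : Finset (Fin n) → ℝ}
    (hφ : IsSubmodularSetFun φ) (σ : Equiv.Perm (Fin n)) (S : Finset (Fin n)) :
    φ ∅ + ∑ k : Fin n, (φ (permPrefix σ ((k : ℕ) + 1)) - φ (permPrefix σ (k : ℕ))) *
      indicatorVec S (σ k) ≤ φ S := by
  let y : ℕ → ℝ := fun k => if h : k < n then indicatorVec S (σ ⟨k, h⟩) else 0
  have hy : ∀ k : Fin n, indicatorVec S (σ k) = y k := fun k => by simp [y]
  have key : ∀ N, N ≤ n → φ ∅ + ∑ k ∈ Finset.range N,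
      (φ (permPrefix σ (k + 1)) - φ (permPrefix σ k)) * y k ≤ φ (S ∩ permPrefix σ N) := by
    intro N
    induction N with
    | zero => simp [permPrefix_zero]
    | succ N ih =>
      intro hN
      have ih := ih (by omega)
      have hN' : N < n := hN
      have hlt : ∀ i, ((σ.symm i : ℕ) < N + 1) ↔ ((σ.symm i : ℕ) < N ∨ i = σ ⟨N, hN'⟩) := by
        intro i
        rw [Nat.lt_succ_iff_lt_or_eq]
        refine or_congr Iff.rfl ⟨fun h => ?_, fun h => by simp [h]⟩
        rw [← Equiv.symm_apply_eq]
        exact Fin.ext h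
      rw [Finset.sum_range_succ]
      by_cases hS : σ ⟨N, hN'⟩ ∈ S
      · have hyN : y N = 1 := by simp [y, hN', indicatorVec, hS]
        have h := hφ (S ∩ permPrefix σ (N + 1)) (permPrefix σ N)
        have h1 : S ∩ permPrefix σ (N + 1) ∪ permPrefix σ N = permPrefix σ (N + 1) := by
          ext i
          simp only [Finset.mem_union, Finset.mem_inter, mem_permPrefix, hlt]
          constructor
          · tauto
          · rintro (h | rfl) <;> tauto
        have h2 : S ∩ permPrefix σ (N + 1) ∩ permPrefix σ N = S ∩ permPrefix σ N := by
          ext i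
          simp only [Finset.mem_inter, mem_permPrefix, hlt]
          tauto
        rw [h1, h2] at h
        rw [hyN]
        linarith
      · have hyN : y N = 0 := by simp [y, hN', indicatorVec, hS]
        have h2 : S ∩ permPrefix σ (N + 1) = S ∩ permPrefix σ N := by
          ext i
          simp only [Finset.mem_inter, mem_permPrefix, hlt]
          constructor
          · rintro ⟨h, h' | rfl⟩
            · exact ⟨h, h'⟩
            · exact absurd h hS
          · tauto
        rw [h2, hyN]
        linarith
  have h := key n le_rfl
  have hall : S ∩ permPrefix σ n = S := by
    ext i
    simp [mem_permPrefix]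
  rw [hall, Finset.sum_range] at h
  simpa only [hy] using h

theorem indicatorVec_mem_Icc {n : ℕ} (T : Finset (Fin n)) (i : Fin n) :
    indicatorVec T i ∈ Set.Icc (0 : ℝ) 1 := by
  by_cases h : i ∈ T <;> simp [indicatorVec, h]

theorem extendedPolymatroidIneq_neg_iff {n : ℕ} (ψ : Finset (Fin n) → ℝ)
    (σ : Equiv.Perm (Fin n)) (θ : ℝ) (x : Fin n → ℝ) :
    ExtendedPolymatroidIneq (fun T => -ψ T) σ (-θ) x ↔
      θ ≤ ψ ∅ + ∑ k : Fin n,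
        (ψ (permPrefix σ ((k : ℕ) + 1)) - ψ (permPrefix σ (k : ℕ))) * x (σ k) := by
  have h : ∑ k : Fin n, (-ψ (permPrefix σ ((k : ℕ) + 1)) - -ψ (permPrefix σ (k : ℕ))) * x (σ k) =
      -∑ k : Fin n, (ψ (permPrefix σ ((k : ℕ) + 1)) - ψ (permPrefix σ (k : ℕ))) * x (σ k) := by
    rw [← Finset.sum_neg_distrib]
    exact Finset.sum_congr rfl fun k _ => by ring
  unfold ExtendedPolymatroidIneq
  rw [h]
  constructor <;> intro h <;> linarith

/-- The convex hull of the hypograph of a supermodular set function is described by the extended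
polymatroid inequalities. -/
theorem convexHull_binaryHypograph_of_submodular {n : ℕ} (g : (Fin n → ℕ) → ℝ)
    (hg : IsSubmodularSetFun fun T => -toSetFun g T) :
    convexHull ℝ (binaryHypograph g) =
      {p | (∀ i, p.2 i ∈ Set.Icc (0 : ℝ) 1) ∧ ∀ σ : Equiv.Perm (Fin n),
        ExtendedPolymatroidIneq (fun T => -toSetFun g T) σ (-p.1) p.2} := by
  apply Set.Subset.antisymm
  · apply convexHull_min
    · rw [binaryHypograph_eq]
      rintro ⟨θ, x⟩ ⟨T, hx, hθ⟩
      simp only at hx hθ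
      subst hx
      refine ⟨indicatorVec_mem_Icc T, fun σ => ?_⟩
      exact (sum_permPrefix_le_of_submodular hg σ T).trans (neg_le_neg hθ)
    · rintro ⟨θ, x⟩ ⟨hx, hθ⟩ ⟨θ', x'⟩ ⟨hx', hθ'⟩ a b ha hb hab
      refine ⟨fun i => (convex_Icc (0 : ℝ) 1) (hx i) (hx' i) ha hb hab, fun σ => ?_⟩
      have h := (extendedPolymatroidIneq_neg_iff _ _ _ _).1 (hθ σ)
      have h' := (extendedPolymatroidIneq_neg_iff _ _ _ _).1 (hθ' σ)
      rw [extendedPolymatroidIneq_neg_iff]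
      simp only [Prod.fst_add, Prod.smul_fst, Prod.snd_add, Prod.smul_snd, Pi.add_apply,
        Pi.smul_apply, smul_eq_mul, mul_add, Finset.sum_add_distrib] at h h' ⊢
      have e : ∀ (t : ℝ) (v : Fin n → ℝ), ∑ k : Fin n, (toSetFun g (permPrefix σ ((k : ℕ) + 1)) -
          toSetFun g (permPrefix σ (k : ℕ))) * (t * v (σ k)) = t * ∑ k : Fin n,
          (toSetFun g (permPrefix σ ((k : ℕ) + 1)) - toSetFun g (permPrefix σ (k : ℕ))) *
            v (σ k) := by
        intro t v
        rw [Finset.mul_sum]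
        exact Finset.sum_congr rfl fun k _ => by ring
      rw [e, e]
      have h1 := mul_le_mul_of_nonneg_left h ha
      have h2 := mul_le_mul_of_nonneg_left h' hb
      have h3 : toSetFun g ∅ = a * toSetFun g ∅ + b * toSetFun g ∅ := by
        rw [← add_mul, hab, one_mul]
      linarith
  · rintro ⟨θ, x⟩ ⟨hx, hθ⟩
    obtain ⟨σ, c, hc, hφ, hsum, hvec⟩ := exists_chain_weights x hx
    have h := (extendedPolymatroidIneq_neg_iff _ _ _ _).1 (hθ σ)
    rw [hφ] at h
    -- Lowering all vertices of the chain by the same slack makes their weighted average exactly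
    -- `(θ, x)`.
    set δ := ∑ k ∈ Finset.range (n + 1), c k * toSetFun g (permPrefix σ k) - θ with hδ
    have hδ0 : 0 ≤ δ := sub_nonneg.2 h
    have hmem : ∀ k ∈ Finset.range (n + 1),
        ((toSetFun g (permPrefix σ k) - δ, indicatorVec (permPrefix σ k)) : ℝ × (Fin n → ℝ)) ∈
          convexHull ℝ (binaryHypograph g) := by
      intro k _
      apply subset_convexHull
      rw [binaryHypograph_eq]
      exact ⟨permPrefix σ k, rfl, by simp [hδ0]⟩
    have hs := (convex_convexHull ℝ (binaryHypograph g)).sum_mem (fun k _ => hc k) hsum hmem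
    convert hs using 1
    refine Prod.ext ?_ ?_
    · simp only [Prod.fst_sum, Prod.smul_fst, smul_eq_mul, mul_sub, Finset.sum_sub_distrib,
        ← Finset.sum_mul, hsum]
      rw [hδ]
      ring
    · simp only [Prod.snd_sum, Prod.smul_snd]
      exact hvec.symm

/-! ### Separation by an affine majorant -/

/-- A point over the cube outside the convex hull of a hypograph is strictly above some affine
majorant. -/
theorem exists_affine_majorant {n : ℕ} (g : (Fin n → ℕ) → ℝ) (θ : ℝ) (x : Fin n → ℝ)
    (hx : ∀ i, x i ∈ Set.Icc (0 : ℝ) 1) (hmem : (θ, x) ∉ convexHull ℝ (binaryHypograph g)) :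
    ∃ (c : Fin n → ℝ) (d : ℝ), (∀ T, toSetFun g T ≤ d - ∑ i, c i * indicatorVec T i) ∧
      d - ∑ i, c i * x i < θ := by
  set K : Set (ℝ × (Fin n → ℝ)) :=
    convexHull ℝ (Set.range fun T : Finset (Fin n) => (toSetFun g T, indicatorVec T)) with hK
  -- Separating the whole upward ray, not just the point, fixes the sign of the `θ`-coefficient `s`:
  -- a negative `s` would be unbounded below on the ray.
  set R : Set (ℝ × (Fin n → ℝ)) := Set.Ici θ ×ˢ {x} with hR
  have hKc : IsCompact K := (Set.finite_range _).isCompact_convexHull (𝕜 := ℝ)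
  have hRc : IsClosed R := isClosed_Ici.prod isClosed_singleton
  have hRconv : Convex ℝ R := (convex_Ici θ).prod (convex_singleton x)
  have hdisj : Disjoint K R := by
    rw [Set.disjoint_left]
    rintro ⟨θ', x'⟩ hk ⟨h1, h2⟩
    simp only [Set.mem_Ici, Set.mem_singleton_iff] at h1 h2
    subst h2
    apply hmem
    have hsub : K ⊆ (fun p : ℝ × (Fin n → ℝ) => (θ - θ', (0 : Fin n → ℝ)) + p) ⁻¹'
        convexHull ℝ (binaryHypograph g) := by
      apply convexHull_min
      · rintro _ ⟨T, rfl⟩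
        apply subset_convexHull
        rw [binaryHypograph_eq]
        exact ⟨T, by simp, by simp; linarith⟩
      · exact (convex_convexHull ℝ _).translate_preimage_right _
    have := hsub hk
    simpa using this
  obtain ⟨F, u, v, hu, huv, hv⟩ :=
    geometric_hahn_banach_compact_closed (convex_convexHull ℝ _) hKc hRconv hRc hdisj
  set s := F (1, 0) with hs
  set c : Fin n → ℝ := fun i => F (0, Pi.single i 1) with hc
  have hF : ∀ (t : ℝ) (y : Fin n → ℝ), F (t, y) = s * t + ∑ i, c i * y i := by
    intro t y
    have h1 : ((t, y) : ℝ × (Fin n → ℝ)) = t • (1, 0) + ∑ i, y i • (0, Pi.single i 1) := by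
      refine Prod.ext ?_ ?_
      · simp [Prod.fst_sum]
      · funext j
        simp [Prod.snd_sum, Finset.sum_apply, Pi.single_apply]
    rw [h1, map_add, map_smul, map_sum]
    simp only [map_smul, smul_eq_mul]
    rw [mul_comm]
    exact congrArg₂ _ rfl (Finset.sum_congr rfl fun i _ => mul_comm _ _)
  have hT : ∀ T, s * toSetFun g T + ∑ i, c i * indicatorVec T i < u := by
    intro T
    rw [← hF]
    exact hu _ (subset_convexHull ℝ _ ⟨T, rfl⟩)
  have hray : ∀ t, 0 ≤ t → v < s * (θ + t) + ∑ i, c i * x i := by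
    intro t ht
    rw [← hF]
    exact hv _ ⟨by simpa using ht, rfl⟩
  have hs0 : 0 ≤ s := by
    by_contra hneg
    push Not at hneg
    have h0 := hray 0 le_rfl
    have h1 := hray ((s * θ + ∑ i, c i * x i - v) / (-s))
      (div_nonneg (by linarith) (by linarith))
    have h2 : s * ((s * θ + ∑ i, c i * x i - v) / (-s)) = -(s * θ + ∑ i, c i * x i - v) := by
      rw [div_neg, mul_neg, mul_div_cancel₀ _ hneg.ne]
    rw [mul_add, h2] at h1
    linarith
  -- If `s = 0`, the hyperplane would be vertical and would separate `x` from all vertices of the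
  -- cube, yet `x` is a convex combination of them.
  have hspos : 0 < s := by
    refine lt_of_le_of_ne hs0 fun h0 => ?_
    obtain ⟨σ, w, hw, -, hsum, hvec⟩ := exists_chain_weights x hx
    have h1 : ∑ k ∈ Finset.range (n + 1), w k * (∑ i, c i * indicatorVec (permPrefix σ k) i) ≤
        ∑ k ∈ Finset.range (n + 1), w k * u := by
      refine Finset.sum_le_sum fun k _ => mul_le_mul_of_nonneg_left ?_ (hw k)
      have := hT (permPrefix σ k)
      rw [← h0] at this
      linarith
    rw [← Finset.sum_mul, hsum, one_mul] at h1
    have h2 : ∑ k ∈ Finset.range (n + 1), w k * (∑ i, c i * indicatorVec (permPrefix σ k) i) =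
        ∑ i, c i * x i := by
      simp_rw [Finset.mul_sum]
      rw [Finset.sum_comm]
      refine Finset.sum_congr rfl fun i _ => ?_
      rw [← congrFun hvec i, Finset.sum_apply, Finset.mul_sum]
      exact Finset.sum_congr rfl fun k _ => by simp; ring
    have h3 := hray 0 le_rfl
    rw [← h0] at h3
    linarith
  refine ⟨fun i => c i / s, u / s, fun T => ?_, ?_⟩
  · have h := hT T
    simp_rw [div_mul_eq_mul_div]
    rw [← Finset.sum_div, ← sub_div, le_div_iff₀ hspos]
    linarith
  · have h := hray 0 le_rfl
    simp_rw [div_mul_eq_mul_div]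
    rw [← Finset.sum_div, ← sub_div, div_lt_iff₀ hspos]
    linarith

/-! ### Subgradients of discretely convex sequences -/

section DiscreteConvex

variable {w : ℕ → ℝ} {m : ℕ}

theorem increment_mono_of_discrete_convex (hw : ∀ k, k + 2 ≤ m → 2 * w (k + 1) ≤ w k + w (k + 2))
    {i j : ℕ} (hij : i ≤ j) (hj : j + 1 ≤ m) : w (i + 1) - w i ≤ w (j + 1) - w j := by
  induction j, hij using Nat.le_induction with
  | base => exact le_rfl
  | succ j _ ih =>
    have h1 := ih (by omega)
    have h2 := hw j (by omega)
    have e : j + 1 + 1 = j + 2 := rfl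
    rw [e]
    linarith

theorem add_mul_le_of_le_increment (hw : ∀ k, k + 2 ≤ m → 2 * w (k + 1) ≤ w k + w (k + 2))
    {z : ℕ} {s : ℝ} (hs : z + 1 ≤ m → s ≤ w (z + 1) - w z) (j : ℕ) (hj : z + j ≤ m) :
    w z + s * j ≤ w (z + j) := by
  induction j with
  | zero => simp
  | succ j ih =>
    have h1 := ih (by omega)
    have h2 := increment_mono_of_discrete_convex hw (show z ≤ z + j by omega) (by omega)
    have h3 := hs (by omega)
    push_cast
    have e : z + (j + 1) = z + j + 1 := rfl
    rw [e]
    linarith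

theorem sub_mul_le_of_increment_le (hw : ∀ k, k + 2 ≤ m → 2 * w (k + 1) ≤ w k + w (k + 2))
    {z : ℕ} {s : ℝ} (hz : z ≤ m) (hs : ∀ y, y + 1 = z → w (y + 1) - w y ≤ s) (j : ℕ)
    (y : ℕ) (hj : y + j = z) : w z - s * j ≤ w y := by
  induction j generalizing y with
  | zero => simp at hj; simp [hj]
  | succ j ih =>
    have h1 := ih (y + 1) (by omega)
    obtain ⟨y', rfl⟩ : ∃ y', z = y' + 1 := ⟨z - 1, by omega⟩
    have h2 := increment_mono_of_discrete_convex hw (show y ≤ y' by omega) hz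
    have h3 := hs y' rfl
    push_cast
    linarith

/-- A slope between the backward and forward increments at `z` is a subgradient. At an end of `[0,
m]` the condition on the missing side is vacuous. -/
theorem tangent_le_of_discrete_convex (hw : ∀ k, k + 2 ≤ m → 2 * w (k + 1) ≤ w k + w (k + 2))
    {z : ℕ} {s : ℝ} (hz : z ≤ m) (hs : ∀ y, y + 1 = z → w (y + 1) - w y ≤ s)
    (hs' : z + 1 ≤ m → s ≤ w (z + 1) - w z) (y : ℕ) (hy : y ≤ m) :
    w z + s * ((y : ℝ) - z) ≤ w y := by
  rcases le_total z y with h | h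
  · obtain ⟨j, rfl⟩ := Nat.exists_eq_add_of_le h
    have := add_mul_le_of_le_increment hw hs' j hy
    push_cast
    linarith
  · obtain ⟨j, rfl⟩ := Nat.exists_eq_add_of_le h
    have := sub_mul_le_of_increment_le hw hz hs j y rfl
    push_cast
    linarith

end DiscreteConvex

/-! ### Hinges: the index family, majorization, interpolation -/

section Hinge

/-- The positive part of the line of slope `s` through the point `(β + l, f l)`. -/
noncomputable def hinge (f : ℕ → ℝ) (β l : ℕ) (s : ℝ) (z : ℕ) : ℝ :=
  max (f l + s * ((z : ℝ) - β - l)) 0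

variable {f : ℕ → ℝ}

/-- A nonpositive increment would force the next one to be negative, against monotonicity. -/
theorem StrictlyConcaveSeq.increment_pos (hm : Monotone f) (hf : StrictlyConcaveSeq f) (k : ℕ) :
    0 < f (k + 1) - f k := by
  have h1 := hf k
  have h2 := hm (show k + 1 ≤ k + 2 by omega)
  linarith

theorem StrictlyConcaveSeq.le_line (hf : StrictlyConcaveSeq f) {l : ℕ} {s : ℝ}
    (h1 : f (l + 1) - f l ≤ s) (h2 : ∀ k, k + 1 = l → s ≤ f (k + 1) - f k) (j : ℕ) :
    f j ≤ f l + s * ((j : ℝ) - l) := by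
  have h := tangent_le_of_discrete_convex (w := fun k => -f k) (m := max l j) (s := -s) (z := l)
    (fun k _ => by have := hf k; linarith) (le_max_left _ _)
    (fun k hk => by have := h2 k hk; linarith) (fun _ => by linarith)
    j (le_max_right _ _)
  linarith

theorem pieceSlope_succ (f : ℕ → ℝ) (k : ℕ) : pieceSlope f (k + 1) = f (k + 1) - f k := by
  simp [pieceSlope]

theorem pieceIntercept_succ (f : ℕ → ℝ) (k : ℕ) :
    pieceIntercept f (k + 1) = f k - (f (k + 1) - f k) * k := by
  simp only [pieceIntercept, pieceSlope_succ]
  push_cast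
  ring

theorem f_pos (hm : Monotone f) (hf : StrictlyConcaveSeq f) (h0 : f 0 = 0) (k : ℕ) :
    0 < f (k + 1) := by
  have h1 := hf.increment_pos hm 0
  have h2 := hm (show 0 + 1 ≤ k + 1 by omega)
  rw [h0] at h1
  linarith

/-- For `ρ = b_ℓ / a_ℓ` one has `ℓ + ρ = f(ℓ) / a_ℓ`, so the slope is `a_ℓ`. -/
theorem hFun_pieceSlope_left (hm : Monotone f) (hf : StrictlyConcaveSeq f) (h0 : f 0 = 0)
    (β k z : ℕ) :
    hFun f β (k + 1, pieceIntercept f (k + 1) / pieceSlope f (k + 1)) z =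
      hinge f β (k + 1) (pieceSlope f (k + 1)) z := by
  have ha : 0 < pieceSlope f (k + 1) := by
    rw [pieceSlope_succ]
    exact hf.increment_pos hm k
  have hp := f_pos hm hf h0 k
  simp only [hFun, hinge]
  have e : f (k + 1) / (((k + 1 : ℕ) : ℝ) + pieceIntercept f (k + 1) / pieceSlope f (k + 1)) =
      pieceSlope f (k + 1) := by
    have : ((k + 1 : ℕ) : ℝ) + pieceIntercept f (k + 1) / pieceSlope f (k + 1) =
        f (k + 1) / pieceSlope f (k + 1) := by
      rw [pieceIntercept]
      field_simp
      ring
    rw [this, div_div_cancel₀ hp.ne']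
  rw [e]
  congr 1
  have : pieceSlope f (k + 1) * (pieceIntercept f (k + 1) / pieceSlope f (k + 1)) =
      f (k + 1) - pieceSlope f (k + 1) * ((k + 1 : ℕ) : ℝ) := by
    rw [mul_div_cancel₀ _ ha.ne', pieceIntercept]
  linear_combination this

/-- The line of slope `a_{l+1}` passes through both graph points `l` and `l + 1`. Hence the smallest
slope allowed at `l` belongs to the `L₁` member at `l + 1`. -/
theorem hinge_succ_eq (β l z : ℕ) :
    hinge f β (l + 1) (pieceSlope f (l + 1)) z = hinge f β l (pieceSlope f (l + 1)) z := by
  simp only [hinge, pieceSlope_succ]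
  congr 1
  push_cast
  ring

theorem hFun_eq_hinge (β l : ℕ) {r : ℝ} (hr : 0 < (l : ℝ) + r) (z : ℕ) :
    hFun f β (l, r) z = hinge f β l (f l / ((l : ℝ) + r)) z := by
  simp only [hFun, hinge]
  congr 1
  field_simp
  ring

/-- The decreasing map `ρ ↦ f(ℓ) / (ℓ + ρ)` sends `b_ℓ / a_ℓ` to `a_ℓ` and `b_{ℓ+1} / a_{ℓ+1}` to
`a_{ℓ+1}`. So `L₂` consists of the slopes strictly between these whose line vanishes at an integer
`β - ρ`. -/
theorem mem_Ioo_iff_slope_mem_Ioo (hm : Monotone f) (hf : StrictlyConcaveSeq f) (k : ℕ) {r : ℝ}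
    (hr : 0 < r) :
    r ∈ Set.Ioo (pieceIntercept f (k + 1) / pieceSlope f (k + 1))
        (pieceIntercept f (k + 1 + 1) / pieceSlope f (k + 1 + 1)) ↔
      f (k + 1) / (((k + 1 : ℕ) : ℝ) + r) ∈
        Set.Ioo (pieceSlope f (k + 1 + 1)) (pieceSlope f (k + 1)) := by
  have h1 := hf.increment_pos hm k
  have h2 := hf.increment_pos hm (k + 1)
  have h3 : 0 < ((k + 1 : ℕ) : ℝ) + r := by positivity
  rw [Set.mem_Ioo, Set.mem_Ioo, pieceIntercept_succ f (k + 1), pieceIntercept, pieceSlope_succ,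
    pieceSlope_succ, div_lt_iff₀ h1, lt_div_iff₀ h2, lt_div_iff₀ h3, div_lt_iff₀ h3]
  constructor <;> rintro ⟨h, h'⟩ <;> constructor <;> linarith

variable {n : ℕ} {ξ : Fin n → ℕ} {β : ℕ}

theorem exists_hinge_of_mem_index (hm : Monotone f) (hf : StrictlyConcaveSeq f) (h0 : f 0 = 0)
    {q : ℕ × ℝ} (hq : q ∈ indexL1 f ξ β ∪ indexL2 f ξ β) :
    ∃ (k : ℕ) (s : ℝ), s ∈ Set.Icc (pieceSlope f (k + 1 + 1)) (pieceSlope f (k + 1)) ∧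
      ∀ z, hFun f β q z = hinge f β (k + 1) s z := by
  obtain ⟨l, r⟩ := q
  rcases hq with ⟨hl, hr⟩ | ⟨hl, ⟨r', hr', hrr⟩, hr⟩
  · simp only [indexL, Finset.mem_Icc] at hl hr
    obtain ⟨k, rfl⟩ : ∃ k, l = k + 1 := ⟨l - 1, by omega⟩
    subst hr
    refine ⟨k, _, ⟨?_, le_rfl⟩, hFun_pieceSlope_left hm hf h0 β k⟩
    rw [pieceSlope_succ, pieceSlope_succ]
    exact (hf k).le
  · simp only [indexL, Finset.mem_Icc] at hl hr hr' hrr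
    obtain ⟨k, rfl⟩ : ∃ k, l = k + 1 := ⟨l - 1, by omega⟩
    have hpos : 0 < r := by
      rw [hrr]
      exact_mod_cast hr'.1
    exact ⟨k, _, Set.Ioo_subset_Icc_self ((mem_Ioo_iff_slope_mem_Ioo hm hf k hpos).1 hr),
      hFun_eq_hinge β (k + 1) (by positivity)⟩

theorem le_hinge (hf : StrictlyConcaveSeq f) (h0 : f 0 = 0)
    {k : ℕ} {s : ℝ} (hs : s ∈ Set.Icc (pieceSlope f (k + 1 + 1)) (pieceSlope f (k + 1)))
    (z : ℕ) : f (z - β) ≤ hinge f β (k + 1) s z := by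
  rcases le_total z β with h | h
  · rw [Nat.sub_eq_zero_of_le h, h0]
    exact le_max_right _ _
  · refine le_trans ?_ (le_max_left _ _)
    rw [pieceSlope_succ, pieceSlope_succ] at hs
    have := hf.le_line (l := k + 1) hs.1 (fun j hj => by
      obtain rfl : j = k := by omega
      exact hs.2) (z - β)
    rwa [Nat.cast_sub h] at this

/-- Convexity and monotonicity in `z`, in the form needed for the cardinalities of an intersection,
two sets and their union. -/
theorem hinge_supermodular {l : ℕ} {s : ℝ} (hs : 0 ≤ s) {a b c d : ℕ} (hab : a ≤ b) (hac : a ≤ c)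
    (h : a + d = b + c) :
    hinge f β l s b + hinge f β l s c ≤ hinge f β l s d + hinge f β l s a := by
  have h1 : s * (a : ℝ) ≤ s * b := mul_le_mul_of_nonneg_left (by exact_mod_cast hab) hs
  have h2 : s * (a : ℝ) ≤ s * c := mul_le_mul_of_nonneg_left (by exact_mod_cast hac) hs
  have h3 : s * (a : ℝ) + s * d = s * b + s * c := by
    rw [← mul_add, ← mul_add]
    exact_mod_cast congrArg (fun t : ℕ => s * (t : ℝ)) h
  have e : ∀ z : ℕ, hinge f β l s z = max (f l - s * (β + l) + s * z) 0 := fun z => by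
    rw [hinge]
    congr 1
    ring
  simp only [e]
  generalize f l - s * (β + l) = t
  rcases le_total (t + s * (b : ℝ)) 0 with hb | hb <;>
    rcases le_total (t + s * (c : ℝ)) 0 with hc | hc
  · rw [max_eq_right hb, max_eq_right hc]
    have := le_max_right (t + s * (d : ℝ)) 0
    have := le_max_right (t + s * (a : ℝ)) 0
    linarith
  · rw [max_eq_right hb, max_eq_left hc]
    have := le_max_left (t + s * (d : ℝ)) 0
    have := le_max_right (t + s * (a : ℝ)) 0
    linarith
  · rw [max_eq_left hb, max_eq_right hc]
    have := le_max_left (t + s * (d : ℝ)) 0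
    have := le_max_right (t + s * (a : ℝ)) 0
    linarith
  · rw [max_eq_left hb, max_eq_left hc]
    have := le_max_left (t + s * (d : ℝ)) 0
    have := le_max_left (t + s * (a : ℝ)) 0
    linarith

/-- Every discretely convex majorant of `z ↦ f (z - β)` lies above a hinge. -/
theorem exists_hinge_le (hf : StrictlyConcaveSeq f) (h0 : f 0 = 0)
    {w : ℕ → ℝ} {N : ℕ} (hN : 1 ≤ N)
    (hw : ∀ k, k + 2 ≤ β + N → 2 * w (k + 1) ≤ w k + w (k + 2))
    (hwf : ∀ z, z ≤ β + N → f (z - β) ≤ w z) (hm : Monotone f) :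
    ∃ (k : ℕ) (s : ℝ), k + 1 ≤ N ∧
      s ∈ Set.Icc (pieceSlope f (k + 1 + 1)) (pieceSlope f (k + 1)) ∧
      (s = pieceSlope f (k + 1) ∨ k + 1 + 1 ≤ N) ∧ ∀ z, z ≤ β + N → hinge f β (k + 1) s z ≤ w z := by
  have hw0 : ∀ z, z ≤ β + N → 0 ≤ w z := fun z hz =>
    (h0.symm.le.trans (hm (Nat.zero_le _))).trans (hwf z hz)
  have hwβ : ∀ j, j ≤ N → f j ≤ w (β + j) := fun j hj => by
    simpa using hwf (β + j) (by omega)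
  have hslope : ∀ k, pieceSlope f (k + 1 + 1) ≤ pieceSlope f (k + 1) := fun k => by
    rw [pieceSlope_succ, pieceSlope_succ]
    exact (hf k).le
  -- Where the gap between `w` and `f` is least, the increments of `w` and of `f` interlace, so a
  -- common supporting slope exists there.
  obtain ⟨l, hl, hmin⟩ := Finset.exists_min_image (Finset.range (N + 1))
    (fun j => w (β + j) - f j) ⟨0, by simp⟩
  simp only [Finset.mem_range, Nat.lt_succ_iff] at hl hmin
  rcases l with _ | k
  · refine ⟨0, pieceSlope f 1, hN, ⟨hslope 0, le_rfl⟩, Or.inl rfl, fun z hz => ?_⟩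
    rw [hinge_succ_eq, hinge]
    refine max_le ?_ (hw0 z hz)
    have hs : 0 < pieceSlope f (0 + 1) := by
      rw [pieceSlope_succ]
      exact hf.increment_pos hm 0
    rcases le_total z β with h | h
    · have h1 : (z : ℝ) ≤ β := by exact_mod_cast h
      have h2 : pieceSlope f (0 + 1) * ((z : ℝ) - β - (0 : ℕ)) ≤ 0 :=
        mul_nonpos_of_nonneg_of_nonpos hs.le (by simpa using h1)
      have := hw0 z hz
      linarith
    · obtain ⟨j, rfl⟩ := Nat.exists_eq_add_of_le h
      have h1 := hmin 1 hN
      have := add_mul_le_of_le_increment hw (z := β) (s := pieceSlope f (0 + 1)) (fun _ => by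
        rw [pieceSlope_succ]
        simp only [add_zero, zero_add] at h1 ⊢
        linarith) j hz
      have h2 := hw0 β (by omega)
      push_cast
      rw [h0]
      linarith
  · have hback := hmin k (by omega)
    by_cases hkN : k + 1 + 1 ≤ N
    · have hfwd := hmin (k + 1 + 1) hkN
      have hc := hw (β + k) (by omega)
      have e1 : β + (k + 1 + 1) = β + k + 2 := rfl
      have e2 : β + (k + 1) = β + k + 1 := rfl
      rw [e2] at hback hfwd
      rw [e1] at hfwd
      -- Minimality at `k + 1` bounds the backward increment of `w` by `a_{k+1}` and the forward one
      -- from below by `a_{k+2}`. The maximum is therefore a subgradient of `w` lying in `[a_{k+2},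
      -- a_{k+1}]`.
      refine ⟨k, max (w (β + k + 1) - w (β + k)) (pieceSlope f (k + 1 + 1)), hl,
        ⟨le_max_right _ _, max_le ?_ (hslope k)⟩, Or.inr hkN, fun z hz => ?_⟩
      · rw [pieceSlope_succ]
        linarith
      · refine max_le ?_ (hw0 z hz)
        have := tangent_le_of_discrete_convex hw (z := β + k + 1)
          (s := max (w (β + k + 1) - w (β + k)) (pieceSlope f (k + 1 + 1))) (by omega)
          (fun y hy => by
            obtain rfl : y = β + k := by omega
            exact le_max_left _ _)
          (fun _ => max_le (by have e3 : β + k + 1 + 1 = β + k + 2 := rfl; rw [e3]; linarith) (by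
            rw [pieceSlope_succ]
            have e3 : β + k + 1 + 1 = β + k + 2 := rfl
            rw [e3]
            linarith)) z hz
        refine le_trans ?_ this
        have h1 := hwβ (k + 1) hl
        rw [e2] at h1
        push_cast
        linarith
    -- Here `k + 1 = N` is the right end: no forward increment constrains the slope, so `a_N`
    -- serves.
    · refine ⟨k, pieceSlope f (k + 1), hl, ⟨hslope k, le_rfl⟩, Or.inl rfl, fun z hz => ?_⟩
      refine max_le ?_ (hw0 z hz)
      have := tangent_le_of_discrete_convex hw (z := β + k + 1)
          (s := pieceSlope f (k + 1)) (by omega)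
          (fun y hy => by
            obtain rfl : y = β + k := by omega
            rw [pieceSlope_succ]
            have e2 : β + (k + 1) = β + k + 1 := rfl
            rw [e2] at hback
            linarith)
          (fun _ => by omega) z hz
      refine le_trans ?_ this
      have h1 := hwβ (k + 1) hl
      have e2 : β + (k + 1) = β + k + 1 := rfl
      rw [e2] at h1
      push_cast
      linarith

/-- A hinge through `(β + l, f l)` is, at the integers, a convex combination of two hinges of the
index family. -/
theorem exists_convex_comb_hFun (hm : Monotone f) (hf : StrictlyConcaveSeq f) (h0 : f 0 = 0)
    {k : ℕ} (hk : k + 1 + 1 ≤ (supportOnes ξ).card - β) {s : ℝ}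
    (hs : s ∈ Set.Icc (pieceSlope f (k + 1 + 1)) (pieceSlope f (k + 1))) :
    ∃ q₁ ∈ indexL1 f ξ β ∪ indexL2 f ξ β, ∃ q₂ ∈ indexL1 f ξ β ∪ indexL2 f ξ β, ∃ a b : ℝ,
      0 ≤ a ∧ 0 ≤ b ∧ a + b = 1 ∧
      ∀ z, hinge f β (k + 1) s z = a * hFun f β q₁ z + b * hFun f β q₂ z := by
  set lo := pieceSlope f (k + 1 + 1) with hlo
  set hi := pieceSlope f (k + 1) with hhi
  have hlohi : lo ≤ hi := hs.1.trans hs.2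
  have hfpos := f_pos hm hf h0 k
  -- The two extreme slopes, together with the admissible slopes whose line vanishes at an integer
  -- `β - r`. Between neighbours in `S` no line of the pencil changes sign at an integer, so the
  -- hinge value there is affine in the slope.
  set S : Finset ℝ := (insert lo (insert hi ((Finset.Icc 1 β).image
    fun r : ℕ => f (k + 1) / (((k + 1 : ℕ) : ℝ) + r)))).filter fun t => t ∈ Set.Icc lo hi with hS
  have hloS : lo ∈ S := by simp [hS, hlohi]
  have hhiS : hi ∈ S := by simp [hS, hlohi]
  have hSq : ∀ t ∈ S, ∃ q ∈ indexL1 f ξ β ∪ indexL2 f ξ β,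
      ∀ z, hFun f β q z = hinge f β (k + 1) t z := by
    intro t ht
    by_cases h1 : t = lo
    · refine ⟨(k + 1 + 1, pieceIntercept f (k + 1 + 1) / pieceSlope f (k + 1 + 1)), Or.inl ⟨?_, rfl⟩,
        fun z => ?_⟩
      · simp only [indexL, Finset.mem_Icc]
        omega
      · rw [hFun_pieceSlope_left hm hf h0, hinge_succ_eq, h1]
    by_cases h2 : t = hi
    · refine ⟨(k + 1, pieceIntercept f (k + 1) / pieceSlope f (k + 1)), Or.inl ⟨?_, rfl⟩,
        fun z => ?_⟩
      · simp only [indexL, Finset.mem_Icc]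
        omega
      · rw [hFun_pieceSlope_left hm hf h0, h2]
    simp only [hS, Finset.mem_filter, Finset.mem_insert, h1, h2, false_or, Finset.mem_image] at ht
    obtain ⟨⟨r, hr, rfl⟩, hlt⟩ := ht
    have hrpos : (0 : ℝ) < r := by exact_mod_cast (Finset.mem_Icc.1 hr).1
    refine ⟨(k + 1, (r : ℝ)), Or.inr ⟨?_, ⟨r, hr, rfl⟩, ?_⟩, hFun_eq_hinge β (k + 1) (by positivity)⟩
    · simp only [indexL, Finset.mem_Icc]
      omega
    · exact (mem_Ioo_iff_slope_mem_Ioo hm hf k hrpos).2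
        ⟨lt_of_le_of_ne hlt.1 (Ne.symm h1), lt_of_le_of_ne hlt.2 h2⟩
  obtain ⟨s₁, h₁, hmax⟩ := Finset.exists_max_image (S.filter (· ≤ s)) id
    ⟨lo, Finset.mem_filter.2 ⟨hloS, hs.1⟩⟩
  obtain ⟨s₂, h₂, hmin⟩ := Finset.exists_min_image (S.filter (s ≤ ·)) id
    ⟨hi, Finset.mem_filter.2 ⟨hhiS, hs.2⟩⟩
  simp only [Finset.mem_filter, id, and_imp] at h₁ hmax h₂ hmin
  obtain ⟨h₁S, h₁s⟩ := h₁
  obtain ⟨h₂S, h₂s⟩ := h₂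
  have hgap : ∀ t ∈ S, t ≤ s₁ ∨ s₂ ≤ t := fun t ht =>
    (le_total t s).imp (hmax t ht) (hmin t ht)
  have hs₁ : lo ≤ s₁ := (Finset.mem_filter.1 h₁S).2.1
  have hs₂ : s₂ ≤ hi := (Finset.mem_filter.1 h₂S).2.2
  -- For `z ≥ β` both lines are nonnegative, since `a_ℓ ℓ ≤ f ℓ`. For `z = β - r` the critical slope
  -- `t` is not strictly between `s₁` and `s₂`.
  have hsign : ∀ z : ℕ, (0 ≤ f (k + 1) + s₁ * ((z : ℝ) - β - (k + 1 : ℕ)) ∧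
      0 ≤ f (k + 1) + s₂ * ((z : ℝ) - β - (k + 1 : ℕ))) ∨
      (f (k + 1) + s₁ * ((z : ℝ) - β - (k + 1 : ℕ)) ≤ 0 ∧
      f (k + 1) + s₂ * ((z : ℝ) - β - (k + 1 : ℕ)) ≤ 0) := by
    intro z
    have hlo0 : 0 < lo := by
      rw [hlo, pieceSlope_succ]
      exact hf.increment_pos hm _
    rcases le_or_gt β z with h | h
    · left
      have hz : (β : ℝ) ≤ z := by exact_mod_cast h
      have key : ∀ t, 0 ≤ t → t ≤ hi → 0 ≤ f (k + 1) + t * ((z : ℝ) - β - (k + 1 : ℕ)) := by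
        intro t ht0 ht
        have h1 : t * ((k + 1 : ℕ) : ℝ) ≤ hi * ((k + 1 : ℕ) : ℝ) :=
          mul_le_mul_of_nonneg_right ht (by positivity)
        have h2 : hi * ((k + 1 : ℕ) : ℝ) ≤ f (k + 1) := by
          have := hf.le_line (l := k + 1) (s := hi) (by rw [← pieceSlope_succ]; exact hlohi)
            (fun j hj => by
              obtain rfl : j = k := by omega
              rw [hhi, pieceSlope_succ]) 0
          rw [h0] at this
          push_cast at this ⊢
          linarith
        have h3 : 0 ≤ t * ((z : ℝ) - β) := mul_nonneg ht0 (by linarith)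
        linarith
      exact ⟨key s₁ (by linarith) (by linarith), key s₂ (by linarith) hs₂⟩
    · obtain ⟨r, hr⟩ : ∃ r, β = z + r := Nat.exists_eq_add_of_le h.le
      have hr1 : 1 ≤ r := by omega
      have hcast : (z : ℝ) - β - (k + 1 : ℕ) = -(((k + 1 : ℕ) : ℝ) + r) := by
        rw [hr]
        push_cast
        ring
      have hden : 0 < ((k + 1 : ℕ) : ℝ) + r := by positivity
      set t := f (k + 1) / (((k + 1 : ℕ) : ℝ) + r) with ht
      have hft : f (k + 1) = t * (((k + 1 : ℕ) : ℝ) + r) := by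
        rw [ht]
        field_simp
      have hcases : t ≤ s₁ ∨ s₂ ≤ t := by
        by_cases hmem : t ∈ Set.Icc lo hi
        · refine hgap t (Finset.mem_filter.2 ⟨?_, hmem⟩)
          refine Finset.mem_insert_of_mem (Finset.mem_insert_of_mem (Finset.mem_image.2 ⟨r, ?_, rfl⟩))
          simp only [Finset.mem_Icc]
          omega
        · rw [Set.mem_Icc, not_and_or, not_le, not_le] at hmem
          exact hmem.imp (fun h => h.le.trans hs₁) (fun h => hs₂.trans h.le)
      rw [hcast, hft]
      rcases hcases with hc | hc
      · right
        constructor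
        · have := mul_le_mul_of_nonneg_right hc hden.le
          linarith
        · have := mul_le_mul_of_nonneg_right (hc.trans (h₁s.trans h₂s)) hden.le
          linarith
      · left
        constructor
        · have := mul_le_mul_of_nonneg_right ((h₁s.trans h₂s).trans hc) hden.le
          linarith
        · have := mul_le_mul_of_nonneg_right hc hden.le
          linarith
  obtain ⟨q₁, hq₁, he₁⟩ := hSq s₁ h₁S
  obtain ⟨q₂, hq₂, he₂⟩ := hSq s₂ h₂S
  have hseg : s ∈ segment ℝ s₁ s₂ := by
    rw [segment_eq_Icc (h₁s.trans h₂s)]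
    exact ⟨h₁s, h₂s⟩
  obtain ⟨a, b, ha, hb, hab, habs⟩ := hseg
  refine ⟨q₁, hq₁, q₂, hq₂, a, b, ha, hb, hab, fun z => ?_⟩
  simp only [smul_eq_mul] at habs
  rw [he₁, he₂]
  simp only [hinge]
  have hlin : f (k + 1) + s * ((z : ℝ) - β - (k + 1 : ℕ)) =
      a * (f (k + 1) + s₁ * ((z : ℝ) - β - (k + 1 : ℕ))) +
      b * (f (k + 1) + s₂ * ((z : ℝ) - β - (k + 1 : ℕ))) := by
    have : f (k + 1) = (a + b) * f (k + 1) := by rw [hab, one_mul]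
    linear_combination this - ((z : ℝ) - β - (k + 1 : ℕ)) * habs
  rcases hsign z with ⟨p1, p2⟩ | ⟨p1, p2⟩
  · rw [max_eq_left p1, max_eq_left p2, hlin, max_eq_left]
    exact add_nonneg (mul_nonneg ha p1) (mul_nonneg hb p2)
  · rw [max_eq_right p1, max_eq_right p2, hlin, max_eq_right]
    · simp
    · exact add_nonpos (mul_nonpos_of_nonneg_of_nonpos ha p1)
        (mul_nonpos_of_nonneg_of_nonpos hb p2)

end Hinge

/-! ### Reduction to cardinalities and the hull of the shifted function -/

section Main

variable {n : ℕ} {ξ : Fin n → ℕ}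

theorem sum_indicator_mul (hξ : IsBinary ξ) (T : Finset (Fin n)) :
    ∑ i, (if i ∈ T then 1 else 0) * ξ i = (T ∩ supportOnes ξ).card := by
  rw [Finset.card_eq_sum_ones, ← Finset.sum_filter_add_sum_filter_not Finset.univ
    (fun i => i ∈ T ∩ supportOnes ξ)]
  have h1 : Finset.univ.filter (fun i => i ∈ T ∩ supportOnes ξ) = T ∩ supportOnes ξ := by
    ext i
    simp
  rw [h1]
  have h2 : ∑ i ∈ Finset.univ.filter (fun i => ¬ i ∈ T ∩ supportOnes ξ),
      (if i ∈ T then 1 else 0) * ξ i = 0 := by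
    refine Finset.sum_eq_zero fun i hi => ?_
    simp only [Finset.mem_filter, Finset.mem_univ, true_and, Finset.mem_inter, supportOnes,
      not_and] at hi
    by_cases hT : i ∈ T
    · simp [(hξ i).resolve_right (hi hT)]
    · simp [hT]
  rw [h2, add_zero]
  refine Finset.sum_congr rfl fun i hi => ?_
  simp only [Finset.mem_inter, supportOnes, Finset.mem_filter, Finset.mem_univ, true_and] at hi
  simp [hi.1, hi.2]

theorem toSetFun_shiftedFun (hξ : IsBinary ξ) (f : ℕ → ℝ) (β : ℕ) (T : Finset (Fin n)) :
    toSetFun (shiftedFun f ξ β) T = f ((T ∩ supportOnes ξ).card - β) := by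
  rw [toSetFun, shiftedFun, sum_indicator_mul hξ]

theorem toSetFun_hShifted (hξ : IsBinary ξ) (f : ℕ → ℝ) (β : ℕ) (q : ℕ × ℝ)
    (T : Finset (Fin n)) :
    toSetFun (hShifted f ξ β q) T = hFun f β q (T ∩ supportOnes ξ).card := by
  rw [toSetFun, hShifted, sum_indicator_mul hξ]

theorem hShifted_submodular {f : ℕ → ℝ} (hm : Monotone f) (hf : StrictlyConcaveSeq f)
    (h0 : f 0 = 0) (hξ : IsBinary ξ) {β : ℕ} {q : ℕ × ℝ}
    (hq : q ∈ indexL1 f ξ β ∪ indexL2 f ξ β) :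
    IsSubmodularSetFun fun T => -toSetFun (hShifted f ξ β q) T := by
  obtain ⟨k, s, hs, he⟩ := exists_hinge_of_mem_index hm hf h0 hq
  have hs0 : 0 ≤ s := by
    refine le_trans ?_ hs.1
    rw [pieceSlope_succ]
    exact (hf.increment_pos hm _).le
  intro R T
  simp only [toSetFun_hShifted hξ, he]
  have h := hinge_supermodular (f := f) (β := β) (l := k + 1) hs0
    (a := (R ∩ T ∩ supportOnes ξ).card) (b := (R ∩ supportOnes ξ).card)
    (c := (T ∩ supportOnes ξ).card) (d := ((R ∪ T) ∩ supportOnes ξ).card)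
    (Finset.card_le_card (Finset.inter_subset_inter_right Finset.inter_subset_left))
    (Finset.card_le_card (Finset.inter_subset_inter_right Finset.inter_subset_right)) (by
      rw [add_comm, Finset.union_inter_distrib_right,
        show R ∩ T ∩ supportOnes ξ = (R ∩ supportOnes ξ) ∩ (T ∩ supportOnes ξ) by
          ext i
          simp only [Finset.mem_inter]
          tauto]
      exact Finset.card_union_add_card_inter _ _)
  linarith

/-- The minimum of an affine function over the sets that meet `Z` in a given number of elements is
a discretely convex function of that number. -/
theorem exists_convex_minorant (Z : Finset (Fin n)) (c : Fin n → ℝ) (d : ℝ) :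
    ∃ w : ℕ → ℝ, (∀ T, w (T ∩ Z).card ≤ d - ∑ i, c i * indicatorVec T i) ∧
      (∀ k, k ≤ Z.card → ∃ T, (T ∩ Z).card = k ∧ d - ∑ i, c i * indicatorVec T i = w k) ∧
      ∀ k, k + 2 ≤ Z.card → 2 * w (k + 1) ≤ w k + w (k + 2) := by
  set F : Finset (Fin n) → ℝ := fun T => d - ∑ i, c i * indicatorVec T i with hF
  have hex : ∀ k, ∃ v : ℝ, (∀ T, (T ∩ Z).card = k → v ≤ F T) ∧
      (k ≤ Z.card → ∃ T, (T ∩ Z).card = k ∧ F T = v) := by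
    intro k
    by_cases hk : k ≤ Z.card
    · obtain ⟨U, hU, hUk⟩ := Finset.exists_subset_card_eq hk
      obtain ⟨T, hT, hmin⟩ := Finset.exists_min_image
        (Finset.univ.filter fun T : Finset (Fin n) => (T ∩ Z).card = k) F
        ⟨U, by simp [Finset.inter_eq_left.2 hU, hUk]⟩
      exact ⟨F T, fun T' hT' => hmin T' (by simpa using hT'),
        fun _ => ⟨T, by simpa using hT, rfl⟩⟩
    -- Beyond `|Z|` the value is arbitrary, because no set meets `Z` in that many elements.
    · refine ⟨0, fun T hT => ?_, fun h => absurd h hk⟩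
      exact absurd (hT ▸ Finset.card_le_card Finset.inter_subset_right) hk
  choose w hw hw' using hex
  refine ⟨w, fun T => hw _ T rfl, hw', fun k hk => ?_⟩
  obtain ⟨A, hA, hAw⟩ := hw' k (by omega)
  obtain ⟨B, hB, hBw⟩ := hw' (k + 2) hk
  -- Exchange: moving `j` from the optimal `B` to the optimal `A` gives two competitors at `k + 1`
  -- with the same total affine value.
  obtain ⟨j, hjB, hjA⟩ : ∃ j ∈ B ∩ Z, j ∉ A ∩ Z := by
    by_contra! h
    have := Finset.card_le_card (show B ∩ Z ⊆ A ∩ Z from h)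
    omega
  rw [Finset.mem_inter] at hjB
  have hjA' : j ∉ A := fun h => hjA (Finset.mem_inter.2 ⟨h, hjB.2⟩)
  have h1 : (insert j A ∩ Z).card = k + 1 := by
    rw [Finset.insert_inter_of_mem hjB.2, Finset.card_insert_of_notMem hjA, hA]
  have h2 : (B.erase j ∩ Z).card = k + 1 := by
    rw [Finset.erase_inter, Finset.card_erase_of_mem (Finset.mem_inter.2 hjB), hB]
    rfl
  have hsum : F (insert j A) + F (B.erase j) = F A + F B := by
    have hpt : ∀ i, indicatorVec (insert j A) i + indicatorVec (B.erase j) i =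
        indicatorVec A i + indicatorVec B i := by
      intro i
      by_cases hij : i = j
      · subst hij
        simp [indicatorVec, hjA', hjB.1]
      · simp [indicatorVec, hij]
    have : ∑ i, c i * indicatorVec (insert j A) i + ∑ i, c i * indicatorVec (B.erase j) i =
        ∑ i, c i * indicatorVec A i + ∑ i, c i * indicatorVec B i := by
      rw [← Finset.sum_add_distrib, ← Finset.sum_add_distrib]
      exact Finset.sum_congr rfl fun i _ => by rw [← mul_add, ← mul_add, hpt]
    simp only [hF]
    linarith
  have h3 := hw _ _ h1
  have h4 := hw _ _ h2
  linarith

/-- Every discretely convex majorant of `z ↦ f (z - β)` lies above a convex combination of two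
functions of the index family. -/
theorem exists_convex_comb_hFun_le {f : ℕ → ℝ} (hm : Monotone f) (hf : StrictlyConcaveSeq f)
    (h0 : f 0 = 0) {β : ℕ} (hβ : β + 1 ≤ (supportOnes ξ).card) {w : ℕ → ℝ}
    (hw : ∀ k, k + 2 ≤ (supportOnes ξ).card → 2 * w (k + 1) ≤ w k + w (k + 2))
    (hwf : ∀ z, z ≤ (supportOnes ξ).card → f (z - β) ≤ w z) :
    ∃ q₁ ∈ indexL1 f ξ β ∪ indexL2 f ξ β, ∃ q₂ ∈ indexL1 f ξ β ∪ indexL2 f ξ β, ∃ a b : ℝ,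
      0 ≤ a ∧ 0 ≤ b ∧ a + b = 1 ∧
      ∀ z, z ≤ (supportOnes ξ).card → a * hFun f β q₁ z + b * hFun f β q₂ z ≤ w z := by
  have hN : β + ((supportOnes ξ).card - β) = (supportOnes ξ).card := by omega
  obtain ⟨k, s, hk, hs, hor, hle⟩ := exists_hinge_le (β := β) hf h0 (w := w)
    (N := (supportOnes ξ).card - β) (by omega) (by rwa [hN]) (by rwa [hN]) hm
  rw [hN] at hle
  rcases hor with rfl | hk'
  · have hq : ((k + 1, pieceIntercept f (k + 1) / pieceSlope f (k + 1)) : ℕ × ℝ) ∈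
        indexL1 f ξ β ∪ indexL2 f ξ β := by
      refine Or.inl ⟨?_, rfl⟩
      simp only [indexL, Finset.mem_Icc]
      omega
    refine ⟨_, hq, _, hq, 1, 0, zero_le_one, le_rfl, add_zero 1, fun z hz => ?_⟩
    rw [hFun_pieceSlope_left hm hf h0, one_mul, zero_mul, add_zero]
    exact hle z hz
  · obtain ⟨q₁, hq₁, q₂, hq₂, a, b, ha, hb, hab, he⟩ := exists_convex_comb_hFun hm hf h0 hk' hs
    exact ⟨q₁, hq₁, q₂, hq₂, a, b, ha, hb, hab, fun z hz => he z ▸ hle z hz⟩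

theorem convexHull_shiftedFun {f : ℕ → ℝ} (hm : Monotone f) (hf : StrictlyConcaveSeq f)
    (h0 : f 0 = 0) (hξ : IsBinary ξ) {β : ℕ} (hβ : β + 1 ≤ (supportOnes ξ).card) :
    convexHull ℝ (binaryHypograph (shiftedFun f ξ β)) =
      ⋂ q ∈ indexL1 f ξ β ∪ indexL2 f ξ β, convexHull ℝ (binaryHypograph (hShifted f ξ β q)) := by
  apply Set.Subset.antisymm
  · refine Set.subset_iInter₂ fun q hq => convexHull_mono ?_
    obtain ⟨k, s, hs, he⟩ := exists_hinge_of_mem_index hm hf h0 hq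
    rintro p ⟨x, hx, hp, hle⟩
    refine ⟨x, hx, hp, hle.trans ?_⟩
    rw [hShifted, he]
    exact le_hinge hf h0 hs _
  · rintro ⟨θ, x⟩ hmem
    rw [Set.mem_iInter₂] at hmem
    have hEP : ∀ q ∈ indexL1 f ξ β ∪ indexL2 f ξ β, (∀ i, x i ∈ Set.Icc (0 : ℝ) 1) ∧
        ∀ σ : Equiv.Perm (Fin n),
          ExtendedPolymatroidIneq (fun T => -toSetFun (hShifted f ξ β q) T) σ (-θ) x := by
      intro q hq
      have := hmem q hq
      rw [convexHull_binaryHypograph_of_submodular _ (hShifted_submodular hm hf h0 hξ hq)] at this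
      exact this
    -- The family is nonempty, as it contains the `L₁` member with `ℓ = 1`; otherwise the
    -- intersection would not confine `x` to the cube.
    have hx : ∀ i, x i ∈ Set.Icc (0 : ℝ) 1 :=
      (hEP (1, pieceIntercept f 1 / pieceSlope f 1) (Or.inl ⟨by
        simp only [indexL, Finset.mem_Icc]
        omega, rfl⟩)).1
    by_contra hnot
    obtain ⟨c, d, hmaj, hlt⟩ := exists_affine_majorant _ θ x hx hnot
    obtain ⟨w, hwle, hwex, hwconv⟩ := exists_convex_minorant (supportOnes ξ) c d
    obtain ⟨q₁, hq₁, q₂, hq₂, a, b, ha, hb, hab, hle⟩ :=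
      exists_convex_comb_hFun_le hm hf h0 hβ hwconv fun z hz => by
        obtain ⟨T, hT, hTw⟩ := hwex z hz
        rw [← hTw, ← hT, ← toSetFun_shiftedFun hξ f β T]
        exact hmaj T
    -- The chain depends on `x` alone, so the inequalities of `q₁` and `q₂` use the same sets and
    -- weights and can be averaged term by term.
    obtain ⟨σ, t, ht, hφ, hsum, hvec⟩ := exists_chain_weights x hx
    have hθ : ∀ q ∈ indexL1 f ξ β ∪ indexL2 f ξ β, θ ≤ ∑ k ∈ Finset.range (n + 1),
        t k * hFun f β q (permPrefix σ k ∩ supportOnes ξ).card := by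
      intro q hq
      have h := (extendedPolymatroidIneq_neg_iff _ _ _ _).1 ((hEP q hq).2 σ)
      rw [hφ] at h
      simpa only [toSetFun_hShifted hξ] using h
    have hd : d - ∑ i, c i * x i = ∑ k ∈ Finset.range (n + 1),
        t k * (d - ∑ i, c i * indicatorVec (permPrefix σ k) i) := by
      simp only [mul_sub, Finset.sum_sub_distrib, ← Finset.sum_mul, hsum, one_mul]
      congr 1
      simp_rw [Finset.mul_sum]
      rw [Finset.sum_comm]
      refine Finset.sum_congr rfl fun i _ => ?_
      rw [← congrFun hvec i, Finset.sum_apply, Finset.mul_sum]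
      exact Finset.sum_congr rfl fun k _ => by simp; ring
    have hbound : a * (∑ k ∈ Finset.range (n + 1),
          t k * hFun f β q₁ (permPrefix σ k ∩ supportOnes ξ).card) +
        b * (∑ k ∈ Finset.range (n + 1),
          t k * hFun f β q₂ (permPrefix σ k ∩ supportOnes ξ).card) ≤ d - ∑ i, c i * x i := by
      rw [hd, Finset.mul_sum, Finset.mul_sum, ← Finset.sum_add_distrib]
      refine Finset.sum_le_sum fun k _ => ?_
      have h1 := (hle _ (Finset.card_le_card
        (Finset.inter_subset_right (s₁ := permPrefix σ k)))).trans (hwle (permPrefix σ k))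
      have h2 := mul_le_mul_of_nonneg_left h1 (ht k)
      linarith
    have h1 := mul_le_mul_of_nonneg_left (hθ q₁ hq₁) ha
    have h2 := mul_le_mul_of_nonneg_left (hθ q₂ hq₂) hb
    have h3 : θ = a * θ + b * θ := by rw [← add_mul, hab, one_mul]
    linarith

end Main

theorem mainTheorem1 (n : ℕ) (f : ℕ → ℝ) (hf_mono : Monotone f)
    (hf_conc : StrictlyConcaveSeq f) (hf_zero : f 0 = 0)
    (ξ : Fin n → ℕ) (hξ : IsBinary ξ) (β : ℕ) (hβ_pos : 1 ≤ β)
    (hβ_le : β + 2 ≤ (supportOnes ξ).card) :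
    convexHull ℝ (binaryHypograph (shiftedFun f ξ β)) =
      (⋂ q ∈ indexL1 f ξ β ∪ indexL2 f ξ β,
        convexHull ℝ (binaryHypograph (hShifted f ξ β q))) ∧
    (∀ q ∈ indexL1 f ξ β ∪ indexL2 f ξ β,
      IsSubmodularSetFun (fun T => -toSetFun (hShifted f ξ β q) T) ∧
      convexHull ℝ (binaryHypograph (hShifted f ξ β q)) =
        {p | (∀ i, p.2 i ∈ Set.Icc (0 : ℝ) 1) ∧ ∀ σ : Equiv.Perm (Fin n),
          ExtendedPolymatroidIneq (fun T => -toSetFun (hShifted f ξ β q) T) σ (-p.1) p.2}) ∧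
    convexHull ℝ (binaryHypograph (shiftedFun f ξ β)) =
      {p | (∀ i, p.2 i ∈ Set.Icc (0 : ℝ) 1) ∧
        ∀ q ∈ indexL1 f ξ β ∪ indexL2 f ξ β, ∀ σ : Equiv.Perm (Fin n),
          ExtendedPolymatroidIneq (fun T => -toSetFun (hShifted f ξ β q) T) σ (-p.1) p.2} := by
  have hhull := convexHull_shiftedFun hf_mono hf_conc hf_zero hξ (β := β) (by omega)
  have hEP : ∀ q ∈ indexL1 f ξ β ∪ indexL2 f ξ β,
      convexHull ℝ (binaryHypograph (hShifted f ξ β q)) =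
        {p | (∀ i, p.2 i ∈ Set.Icc (0 : ℝ) 1) ∧ ∀ σ : Equiv.Perm (Fin n),
          ExtendedPolymatroidIneq (fun T => -toSetFun (hShifted f ξ β q) T) σ (-p.1) p.2} :=
    fun q hq => convexHull_binaryHypograph_of_submodular _
      (hShifted_submodular hf_mono hf_conc hf_zero hξ hq)
  refine ⟨hhull, fun q hq => ⟨hShifted_submodular hf_mono hf_conc hf_zero hξ hq, hEP q hq⟩, ?_⟩
  rw [hhull]
  ext p
  rw [Set.mem_iInter₂]
  constructor
  · intro h
    have h' := fun q hq => (hEP q hq).subset (h q hq)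
    refine ⟨(h' (1, pieceIntercept f 1 / pieceSlope f 1) (Or.inl ⟨?_, rfl⟩)).1,
      fun q hq => (h' q hq).2⟩
    simp only [indexL, Finset.mem_Icc]
    omega
  · rintro ⟨hx, h⟩ q hq
    exact (hEP q hq).superset ⟨hx, h q hq⟩
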